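/- Let $\Delta\subset\mathfrak t^*$ be a finite reduced crystallographic root system spanning the real vector space $\mathfrak t^*$, with a choice of simple roots, positive roots $\Delta^+$, $\Delta^-=-\Delta^+$, Weyl group $W$ with length function $\ell$ and strong Bruhat order $\preccurlyeq$. Let $S=\mathbb S(\mathfrak t^*)$ be the symmetric algebra, with the induced action of $W$. Let $H_\alpha^*(W)$ be the ring of all maps $f\colon W\to S$ such that $f(ws_\beta)-f(w)\in (w\beta)S$ for all $w\in W$, $\beta\in\Delta^+$; it is an $S$-module under pointwise multiplication. For $f\in H_\alpha^*(W)$ and $w\in W$ let $f^w\colon W\to S$ be $f^w(v)=w^{-1}\cdot f(wv)$. Let $\leq_L$ be the left weak order: $v\leq_L u\iff \ell(uv^{-1})=\ell(u)-\ell(v)$. Theorem. For every $u\in W$ there is exactly one $\tau_u\in H_\alpha^*(W)$ (the equivariant Schubert class of $u$) all of whose values are homogeneous of polynomial degree $\ell(u)$, such that $\tau_u(v)=0$ unless $u\preccurlyeq v$, and such that $\tau_u(u)=\prod\{\beta\in\Delta^+ : u^{-1}\beta\in\Delta^-\}$. For all $a,w\in W$, $$\tau_a=\sum_{b\leq_L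 a}\tau_{ab^{-1}}(w^{-1})\,\tau_b^w ,\qquad \tau_a^w=\sum_{b\leq_L a}(-1)^{\ell(ba^{-1})}\,\tau_{ba^{-1}}(w^{-1})\,\tau_b .$$ Moreover, for every $w\in W$, both $\{\tau_u : u\in W\}$ and $\{\tau_u^w : u\in W\}$ are bases of the $S$-module $H_\alpha^*(W)$, and the two transition matrices between them, whose $(u,v)$ entries are, for $v\leq_L u$, $\tau_{uv^{-1}}(w^{-1})$ and $(-1)^{\ell(vu^{-1})}\tau_{vu^{-1}}(w^{-1})$ respectively, and $0$ otherwise, are lower triangular with respect to $\leq_L$ with all diagonal entries $1$, and are inverse to each other. -/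

import Mathlib

noncomputable section

namespace Schubert

variable {ι M N : Type*} [AddCommGroup M] [Module ℝ M] [AddCommGroup N] [Module ℝ N]

/-- The Weyl group of a finite root system is finite. -/
instance finite_weylGroup [Finite ι] (P : RootPairing ι ℝ M N) [P.IsRootSystem] :
    Finite P.weylGroup := by
  have hinj : Function.Injective (fun (g : P.weylGroup) (i : ι) => g • i) := by
    intro g h hgh
    apply Subtype.ext
    apply RootPairing.Equiv.weightHom_injective P
    apply LinearEquiv.toLinearMap_injective
    refine LinearMap.ext_on_range (v := P.root) RootPairing.IsRootSystem.span_root_eq_top fun i => ?_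
    have h1 := P.weylGroup_apply_root g i
    have h2 := P.weylGroup_apply_root h i
    have h3 : P.weylGroupToPerm g i = P.weylGroupToPerm h i := congrFun hgh i
    exact h1.trans ((congrArg P.root h3).trans h2.symm)
  exact Finite.of_injective _ hinj

instance fintype_weylGroup [Finite ι] (P : RootPairing ι ℝ M N) [P.IsRootSystem] :
    Fintype P.weylGroup := Fintype.ofFinite _

instance decidableEq_weylGroup (P : RootPairing ι ℝ M N) : DecidableEq P.weylGroup :=
  Classical.decEq _

/-- The action of a Weyl group element `w` on the symmetric algebra `S(𝔱*)` (here `𝔱* = M`):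
the algebra map that extends the action of `w` on `𝔱*`. -/
def symAct {P : RootPairing ι ℝ M N} (w : P.weylGroup) :
    SymmetricAlgebra ℝ M →ₐ[ℝ] SymmetricAlgebra ℝ M :=
  SymmetricAlgebra.lift (SymmetricAlgebra.ι ℝ M ∘ₗ P.weylGroupRootRep w)

/-- The homogeneous part `S^k(𝔱*)` of polynomial degree `k` (cohomological degree `2k`): the span
of the products of `k` elements of `𝔱*`. -/
def symDegree (M : Type*) [AddCommGroup M] [Module ℝ M] (k : ℕ) :
    Submodule ℝ (SymmetricAlgebra ℝ M) :=
  LinearMap.range (SymmetricAlgebra.ι ℝ M) ^ k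

/-- The length `ℓ(w)`: the least number of factors in an expression of `w` as a product of simple
reflections. -/
def length {P : RootPairing ι ℝ M N} (b : P.Base) (w : P.weylGroup) : ℕ :=
  sInf {n | ∃ l : List b.support,
    l.length = n ∧ (l.map fun i => RootPairing.weylGroup.ofIdx P i.1).prod = w}

/-- The strong Bruhat order: generated by `u ≺ u s_β` whenever `β` is a root with
`ℓ(u) < ℓ(u s_β)`. -/
def BruhatLE {P : RootPairing ι ℝ M N} (b : P.Base) : P.weylGroup → P.weylGroup → Prop :=
  Relation.ReflTransGen fun u v =>
    (∃ i : ι, v = u * RootPairing.weylGroup.ofIdx P i) ∧ length b u < length b v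

/-- The left weak order: `v ≤_L u` iff `ℓ(u v⁻¹) = ℓ(u) - ℓ(v)`. -/
def LeftWeakLE {P : RootPairing ι ℝ M N} (b : P.Base) (v u : P.weylGroup) : Prop :=
  (length b (u * v⁻¹) : ℤ) = (length b u : ℤ) - (length b v : ℤ)

instance decidableRel_leftWeakLE {P : RootPairing ι ℝ M N} (b : P.Base) :
    DecidableRel (LeftWeakLE b) := Classical.decRel _

/-- The ring `H_α^*(W)`, as an `S(𝔱*)`-subalgebra of the ring of all maps `W → S(𝔱*)`: the maps `f`
such that `f (w s_β) - f w` is a multiple of `w β` for all `w ∈ W` and all positive roots `β`. -/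
def cohomology {P : RootPairing ι ℝ M N} (b : P.Base) :
    Subalgebra (SymmetricAlgebra ℝ M) (P.weylGroup → SymmetricAlgebra ℝ M) where
  carrier := {f | ∀ (w : P.weylGroup) (i : ι), b.IsPos i →
    SymmetricAlgebra.ι ℝ M (w • P.root i) ∣ f (w * RootPairing.weylGroup.ofIdx P i) - f w}
  mul_mem' := by
    intro f g hf hg w i hi
    have h : (f * g) (w * RootPairing.weylGroup.ofIdx P i) - (f * g) w
        = f (w * RootPairing.weylGroup.ofIdx P i) * (g (w * RootPairing.weylGroup.ofIdx P i) - g w)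
          + (f (w * RootPairing.weylGroup.ofIdx P i) - f w) * g w := by
      simp only [Pi.mul_apply]; ring
    rw [h]
    exact dvd_add (Dvd.dvd.mul_left (hg w i hi) _) (Dvd.dvd.mul_right (hf w i hi) _)
  add_mem' := by
    intro f g hf hg w i hi
    have h : (f + g) (w * RootPairing.weylGroup.ofIdx P i) - (f + g) w
        = (f (w * RootPairing.weylGroup.ofIdx P i) - f w)
          + (g (w * RootPairing.weylGroup.ofIdx P i) - g w) := by
      simp only [Pi.add_apply]; ring
    rw [h]
    exact dvd_add (hf w i hi) (hg w i hi)
  algebraMap_mem' := by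
    intro r w i _
    simp [Pi.algebraMap_apply]

/-- The equivariant Schubert class of `u`, by its characterization: the class in `H_α^*(W)` that is
homogeneous of degree `2ℓ(u)`, is supported on `{v | u ≼ v}` for the strong Bruhat order, and whose
value at `u` is the product of the positive roots `β` such that `u⁻¹β` is negative. -/
structure IsSchubertClass {P : RootPairing ι ℝ M N} (b : P.Base) (u : P.weylGroup)
    (f : P.weylGroup → SymmetricAlgebra ℝ M) : Prop where
  mem_cohomology : f ∈ cohomology b
  homogeneous : ∀ v, f v ∈ symDegree M (length b u)
  support : ∀ v, f v ≠ 0 → BruhatLE b u v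
  apply_self : f u = ∏ᶠ (i : ι) (_ : b.IsPos i ∧ ¬ b.IsPos (u⁻¹ • i)),
    SymmetricAlgebra.ι ℝ M (P.root i)

/-- The permuted class `f^w`, given by `f^w(v) = w⁻¹ · f(w v)`. -/
def permute {P : RootPairing ι ℝ M N} (w : P.weylGroup)
    (f : P.weylGroup → SymmetricAlgebra ℝ M) : P.weylGroup → SymmetricAlgebra ℝ M :=
  fun v => symAct w⁻¹ (f (w * v))

/-- The family `τ` is a basis of the `S(𝔱*)`-module `H_α^*(W)`. -/
def IsCohomologyBasis {P : RootPairing ι ℝ M N} (b : P.Base)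
    (τ : P.weylGroup → P.weylGroup → SymmetricAlgebra ℝ M) : Prop :=
  LinearIndependent (SymmetricAlgebra ℝ M) τ ∧
    Submodule.span (SymmetricAlgebra ℝ M) (Set.range τ) = Subalgebra.toSubmodule (cohomology b)

/-- The matrix with entries `τ_{u v⁻¹}(w⁻¹)` for `v ≤_L u`, and `0` otherwise. -/
def matrixToPermuted {P : RootPairing ι ℝ M N} (b : P.Base)
    (τ : P.weylGroup → P.weylGroup → SymmetricAlgebra ℝ M) (w : P.weylGroup) :
    Matrix P.weylGroup P.weylGroup (SymmetricAlgebra ℝ M) :=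
  fun u v => if LeftWeakLE b v u then τ (u * v⁻¹) w⁻¹ else 0

/-- The matrix with entries `(-1)^{ℓ(v u⁻¹)} τ_{v u⁻¹}(w⁻¹)` for `v ≤_L u`, and `0` otherwise. -/
def matrixFromPermuted {P : RootPairing ι ℝ M N} (b : P.Base)
    (τ : P.weylGroup → P.weylGroup → SymmetricAlgebra ℝ M) (w : P.weylGroup) :
    Matrix P.weylGroup P.weylGroup (SymmetricAlgebra ℝ M) :=
  fun u v => if LeftWeakLE b v u then (-1) ^ length b (v * u⁻¹) * τ (v * u⁻¹) w⁻¹ else 0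

/-- Lower triangular for the left weak order, with all diagonal entries equal to `1`. -/
def IsUnitriangular {P : RootPairing ι ℝ M N} (b : P.Base)
    (A : Matrix P.weylGroup P.weylGroup (SymmetricAlgebra ℝ M)) : Prop :=
  (∀ u, A u u = 1) ∧ ∀ u v, A u v ≠ 0 → LeftWeakLE b v u

end Schubert

end

set_option linter.unusedSectionVars false

universe u

namespace Schubert

open RootPairing
open RootPairing.weylGroup (ofIdx)

variable {ι M N : Type*} [AddCommGroup M] [Module ℝ M] [AddCommGroup N] [Module ℝ N]
variable {P : RootPairing ι ℝ M N}

/-! ### The action of the Weyl group on roots -/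

/-! The engine is the left divided difference: for a class `f` and a reflection `s_i`, `f - f^{s_i}`
is `α_i` times another class (`exists_divided_difference`). Rigidity comes from degrees: at an
argument `v` of minimal length in its support, a class is divisible by the product of the `ℓ(v)`
inversions, so its value cannot be homogeneous of degree below `ℓ(v)`
(`eq_zero_of_degree_lt_length`). This gives uniqueness of Schubert classes. Existence is a
descending induction on length: an element with all simple reflections as left descents carries a
class concentrated at one point, and divided differences produce the rest.

Rigidity also shows that, for simple `s_i`, `τ_u^{s_i} = τ_u - α_i τ_{s_i u}` if `s_i u < u`, and
`τ_u^{s_i} = τ_u` otherwise (`permute_ofIdx_schubert`). Both transition formulas follow by induction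
along a reduced word of `w⁻¹`: the recursion for the classes matches that for their values at `s_i
x`, the index sets agreeing by `leftWeakLE_ofIdx_mul_iff` and `ofIdx_mul_leftWeakLE_iff`. The basis
property is triangularity in the length, and the matrices are inverse because the two expansions
undo each other. -/

theorem root_smul (w : P.weylGroup) (i : ι) : P.root (w • i) = w • P.root i :=
  (P.weylGroup_apply_root w i).symm

theorem weylGroup_ext {g h : P.weylGroup} (H : ∀ x : M, g • x = h • x) : g = h :=
  Subtype.ext <| Equiv.weightHom_injective P <| LinearEquiv.ext H

theorem ofIdx_smul_weight (i : ι) (x : M) : ofIdx P i • x = P.reflection i x := rfl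

theorem ofIdx_smul_index (i j : ι) : ofIdx P i • j = P.reflectionPerm i j := rfl

@[simp]
theorem ofIdx_mul_self (i : ι) : ofIdx P i * ofIdx P i = 1 :=
  weylGroup_ext fun x => by simp [mul_smul]

@[simp]
theorem ofIdx_inv (i : ι) : (ofIdx P i)⁻¹ = ofIdx P i :=
  inv_eq_of_mul_eq_one_left (ofIdx_mul_self i)

@[simp]
theorem ofIdx_mul_cancel_left (i : ι) (w : P.weylGroup) : ofIdx P i * (ofIdx P i * w) = w := by
  rw [← mul_assoc, ofIdx_mul_self, one_mul]

@[simp]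
theorem ofIdx_mul_cancel_right (i : ι) (w : P.weylGroup) : w * ofIdx P i * ofIdx P i = w := by
  rw [mul_assoc, ofIdx_mul_self, mul_one]

@[simp]
theorem ofIdx_smul_smul (i j : ι) : ofIdx P i • ofIdx P i • j = j := by
  rw [← mul_smul, ofIdx_mul_self, one_smul]

theorem ofIdx_smul_root_self (i : ι) : P.root (ofIdx P i • i) = -P.root i := by
  simp [ofIdx_smul_index]

theorem ofIdx_ofIdx_smul (i j : ι) :
    ofIdx P (ofIdx P i • j) = ofIdx P i * ofIdx P j * ofIdx P i :=
  weylGroup_ext fun x => by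
    simp [mul_smul, ofIdx_smul_index, reflection_reflectionPerm]

/-- Conjugating a reflection moves its root. The definitions of the Bruhat order and of the classes
multiply on the right, whereas the proof works on the left; this is the translation. -/
theorem mul_ofIdx_eq (w : P.weylGroup) (i : ι) : w * ofIdx P i = ofIdx P (w • i) * w := by
  obtain ⟨w, hw⟩ := w
  induction hw using weylGroup.induction generalizing i with
  | mem j =>
    change ofIdx P j * ofIdx P i = ofIdx P (ofIdx P j • i) * ofIdx P j
    simp [ofIdx_ofIdx_smul]
  | one => exact (one_mul _).trans (mul_one _).symm
  | mul x y hx hy ihx ihy =>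
    change (⟨x, hx⟩ * ⟨y, hy⟩ : P.weylGroup) * ofIdx P i
      = ofIdx P ((⟨x, hx⟩ * ⟨y, hy⟩ : P.weylGroup) • i) * (⟨x, hx⟩ * ⟨y, hy⟩)
    rw [mul_assoc, ihy, ← mul_assoc, ihx, mul_smul, mul_assoc]

theorem ofIdx_ofIdx_smul_self (i : ι) : ofIdx P (ofIdx P i • i) = ofIdx P i := by
  simp [ofIdx_ofIdx_smul]

theorem isPos_ofIdx_smul_self (b : P.Base) (i : ι) : b.IsPos (ofIdx P i • i) ↔ ¬ b.IsPos i :=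
  Base.IsPos.neg_iff_not b i

theorem isPos_mul_ofIdx_smul_self (b : P.Base) (w : P.weylGroup) (i : ι) :
    b.IsPos ((w * ofIdx P i) • i) ↔ ¬ b.IsPos (w • i) := by
  rw [mul_ofIdx_eq, mul_smul, isPos_ofIdx_smul_self]

theorem isPos_smul_ofIdx_smul_self (b : P.Base) (w : P.weylGroup) (i : ι) :
    b.IsPos (w • ofIdx P i • i) ↔ ¬ b.IsPos (w • i) := by
  rw [← mul_smul, isPos_mul_ofIdx_smul_self]

section Crystallographic

variable [Finite ι] [P.IsCrystallographic] [P.IsReduced] {b : P.Base}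

theorem isPos_ofIdx_smul {i j : ι} (hi : i ∈ b.support) (hj : b.IsPos j) (hij : j ≠ i) :
    b.IsPos (ofIdx P i • j) :=
  hj.reflectionPerm hi hij

theorem eq_of_isPos_of_not_isPos_ofIdx_smul {i j : ι} (hi : i ∈ b.support) (hj : b.IsPos j)
    (h : ¬ b.IsPos (ofIdx P i • j)) : j = i := by
  by_contra hij
  exact h (isPos_ofIdx_smul hi hj hij)

/-! ### Words and length -/

/-- The product of a word in the simple reflections. -/
noncomputable def wordProd (b : P.Base) (l : List b.support) : P.weylGroup :=
  (l.map fun i => ofIdx P i.1).prod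

theorem wordProd_nil : wordProd b [] = 1 := rfl

theorem wordProd_cons (i : b.support) (l : List b.support) :
    wordProd b (i :: l) = ofIdx P i * wordProd b l := rfl

theorem wordProd_append (l₁ l₂ : List b.support) :
    wordProd b (l₁ ++ l₂) = wordProd b l₁ * wordProd b l₂ := by
  simp [wordProd]

theorem wordProd_reverse (l : List b.support) : wordProd b l.reverse = (wordProd b l)⁻¹ := by
  induction l with
  | nil => simp [wordProd]
  | cons i l ih => simp [wordProd_append, ih, wordProd_cons, wordProd_nil]

theorem length_wordProd_le (l : List b.support) : length b (wordProd b l) ≤ l.length :=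
  Nat.sInf_le ⟨l, rfl, rfl⟩

theorem exists_wordProd_eq_ofIdx (b : P.Base) (i : ι) :
    ∃ l : List b.support, wordProd b l = ofIdx P i := by
  induction i using b.induction_reflect with
  | h₀ i h =>
    rwa [← ofIdx_smul_index, ofIdx_ofIdx_smul_self]
  | h₁ i hi => exact ⟨[⟨i, hi⟩], by simp [wordProd]⟩
  | h₂ i j h hj =>
    obtain ⟨l, hl⟩ := h
    refine ⟨⟨j, hj⟩ :: (l ++ [⟨j, hj⟩]), ?_⟩
    rw [← ofIdx_smul_index, ofIdx_ofIdx_smul, wordProd_cons, wordProd_append, hl]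
    simp [wordProd, mul_assoc]

theorem exists_wordProd_eq (b : P.Base) (w : P.weylGroup) :
    ∃ l : List b.support, wordProd b l = w := by
  obtain ⟨w, hw⟩ := w
  induction hw using weylGroup.induction with
  | mem i => exact exists_wordProd_eq_ofIdx b i
  | one => exact ⟨[], rfl⟩
  | mul x y hx hy ihx ihy =>
    obtain ⟨l₁, h₁⟩ := ihx
    obtain ⟨l₂, h₂⟩ := ihy
    exact ⟨l₁ ++ l₂, by rw [wordProd_append, h₁, h₂]; rfl⟩

theorem exists_reduced_word (b : P.Base) (w : P.weylGroup) :
    ∃ l : List b.support, l.length = length b w ∧ wordProd b l = w := by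
  obtain ⟨l, hl⟩ := exists_wordProd_eq b w
  exact Nat.sInf_mem (s := {n | ∃ l : List b.support, l.length = n ∧ wordProd b l = w})
    ⟨_, l, rfl, hl⟩

theorem length_one (b : P.Base) : length b 1 = 0 :=
  Nat.le_zero.1 (length_wordProd_le (b := b) [])

theorem length_mul_le (b : P.Base) (v w : P.weylGroup) :
    length b (v * w) ≤ length b v + length b w := by
  obtain ⟨l₁, h₁, rfl⟩ := exists_reduced_word b v
  obtain ⟨l₂, h₂, rfl⟩ := exists_reduced_word b w
  rw [← wordProd_append, ← h₁, ← h₂, ← List.length_append]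
  exact length_wordProd_le _

theorem length_ofIdx_le {i : ι} (hi : i ∈ b.support) : length b (ofIdx P i) ≤ 1 := by
  simpa [wordProd] using length_wordProd_le (b := b) [⟨i, hi⟩]

theorem length_inv (b : P.Base) (w : P.weylGroup) : length b w⁻¹ = length b w := by
  have key : ∀ w : P.weylGroup, length b w⁻¹ ≤ length b w := fun w => by
    obtain ⟨l, hl, rfl⟩ := exists_reduced_word b w
    rw [← wordProd_reverse, ← hl, ← List.length_reverse]
    exact length_wordProd_le _
  exact (key w).antisymm (by simpa using key w⁻¹)

/-- The exchange property. -/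
theorem exists_shorter_word (l : List b.support) {j : ι} (hj : b.IsPos j)
    (h : ¬ b.IsPos (wordProd b l • j)) :
    ∃ l' : List b.support, l'.length < l.length ∧ wordProd b l' = wordProd b l * ofIdx P j := by
  induction l with
  | nil => simp [wordProd_nil, hj] at h
  | cons i l ih =>
    by_cases hl : b.IsPos (wordProd b l • j)
    · rw [wordProd_cons, mul_smul] at h
      -- The root changes sign at the letter `i`, so it equals `α_i` just before; deleting that
      -- letter gives the shorter word.
      have hij := eq_of_isPos_of_not_isPos_ofIdx_smul i.2 hl h
      refine ⟨l, by simp, ?_⟩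
      rw [wordProd_cons, mul_assoc, mul_ofIdx_eq, hij, ofIdx_mul_cancel_left]
    · obtain ⟨l', hl', h'⟩ := ih hl
      exact ⟨i :: l', by simpa using hl', by rw [wordProd_cons, wordProd_cons, h', mul_assoc]⟩

theorem length_mul_ofIdx_lt {w : P.weylGroup} {j : ι} (hj : b.IsPos j) (h : ¬ b.IsPos (w • j)) :
    length b (w * ofIdx P j) < length b w := by
  obtain ⟨l, hl, rfl⟩ := exists_reduced_word b w
  obtain ⟨l', hl', h'⟩ := exists_shorter_word l hj h
  rw [← h', ← hl]
  exact (length_wordProd_le _).trans_lt hl'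

theorem lt_length_mul_ofIdx {w : P.weylGroup} {j : ι} (hj : b.IsPos j) (h : b.IsPos (w • j)) :
    length b w < length b (w * ofIdx P j) := by
  have := length_mul_ofIdx_lt (w := w * ofIdx P j) hj (by simpa [isPos_mul_ofIdx_smul_self])
  rwa [ofIdx_mul_cancel_right] at this

theorem lt_length_mul_ofIdx_iff {w : P.weylGroup} {j : ι} (hj : b.IsPos j) :
    length b w < length b (w * ofIdx P j) ↔ b.IsPos (w • j) :=
  ⟨fun h => by_contra fun h' => h.asymm (length_mul_ofIdx_lt hj h'), lt_length_mul_ofIdx hj⟩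

theorem length_ofIdx_mul_eq_inv (b : P.Base) (w : P.weylGroup) (j : ι) :
    length b (ofIdx P j * w) = length b (w⁻¹ * ofIdx P j) := by
  rw [← length_inv b (ofIdx P j * w), mul_inv_rev, ofIdx_inv]

theorem length_ofIdx_mul_lt {w : P.weylGroup} {j : ι} (hj : b.IsPos j)
    (h : ¬ b.IsPos (w⁻¹ • j)) : length b (ofIdx P j * w) < length b w := by
  rw [length_ofIdx_mul_eq_inv, ← length_inv b w]
  exact length_mul_ofIdx_lt hj h

theorem lt_length_ofIdx_mul_iff {w : P.weylGroup} {j : ι} (hj : b.IsPos j) :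
    length b w < length b (ofIdx P j * w) ↔ b.IsPos (w⁻¹ • j) := by
  rw [length_ofIdx_mul_eq_inv, ← length_inv b w]
  exact lt_length_mul_ofIdx_iff hj

/-- Subadditivity bounds the change by one, and the sign of `w⁻¹ α_i` rules out equality. -/
theorem length_ofIdx_mul (w : P.weylGroup) {i : ι} (hi : i ∈ b.support) :
    length b (ofIdx P i * w) = length b w + 1 ∨ length b w = length b (ofIdx P i * w) + 1 := by
  have h₁ := length_mul_le b (ofIdx P i) w
  have h₂ := length_mul_le b (ofIdx P i) (ofIdx P i * w)
  have h₃ := length_ofIdx_le hi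
  rw [ofIdx_mul_cancel_left] at h₂
  by_cases h : b.IsPos (w⁻¹ • i)
  · have := (lt_length_ofIdx_mul_iff (Base.isPos_of_mem_support hi)).2 h
    omega
  · have := length_ofIdx_mul_lt (Base.isPos_of_mem_support hi) h
    omega

/-- Induction on a Weyl group element along a reduced word. -/
theorem weylGroup_induction (b : P.Base) {p : P.weylGroup → Prop} (one : p 1)
    (step : ∀ i ∈ b.support, ∀ w, length b w < length b (ofIdx P i * w) → p w →
      p (ofIdx P i * w)) (w : P.weylGroup) : p w := by
  obtain ⟨l, hl, rfl⟩ := exists_reduced_word b w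
  induction l with
  | nil => exact one
  | cons i l ih =>
    have h₁ := length_wordProd_le l
    have h₂ := length_ofIdx_mul (wordProd b l) i.2
    rw [wordProd_cons] at hl ⊢
    simp only [List.length_cons] at hl
    exact step i i.2 _ (by omega) (ih (by omega))

/-! ### Inversions -/

/-- The positive roots `β` with `u⁻¹ β` negative. -/
def inversions (b : P.Base) (u : P.weylGroup) : Set ι := {i | b.IsPos i ∧ ¬ b.IsPos (u⁻¹ • i)}

theorem inversions_one (b : P.Base) : inversions b (1 : P.weylGroup) = ∅ := by
  ext i
  simp [inversions]

/-- A simple reflection permutes the positive roots other than its own. -/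
theorem inversions_ofIdx_mul {u : P.weylGroup} {i : ι} (hi : i ∈ b.support)
    (h : b.IsPos (u⁻¹ • i)) :
    inversions b (ofIdx P i * u) = insert i ((ofIdx P i • ·) '' inversions b u) := by
  ext k
  simp only [inversions, mul_inv_rev, ofIdx_inv, mul_smul, Set.mem_ofPred_eq, Set.mem_insert_iff,
    Set.mem_image]
  constructor
  · rintro ⟨hk, hk'⟩
    refine or_iff_not_imp_left.2 fun hki => ?_
    exact ⟨ofIdx P i • k, ⟨isPos_ofIdx_smul hi hk hki, hk'⟩, by simp⟩
  · rintro (rfl | ⟨j, ⟨hj, hj'⟩, rfl⟩)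
    · exact ⟨Base.isPos_of_mem_support hi, by simpa [isPos_smul_ofIdx_smul_self]⟩
    · refine ⟨isPos_ofIdx_smul hi hj ?_, by simpa⟩
      rintro rfl
      exact hj' h

theorem notMem_image_inversions {u : P.weylGroup} {i : ι} (hi : i ∈ b.support) :
    i ∉ (ofIdx P i • ·) '' inversions b u := by
  rintro ⟨j, ⟨hj, -⟩, hji⟩
  have : j = ofIdx P i • i := (ofIdx_smul_smul i j).symm.trans (congrArg _ hji)
  rw [this, isPos_ofIdx_smul_self] at hj
  exact hj (Base.isPos_of_mem_support hi)

theorem ncard_inversions (b : P.Base) (u : P.weylGroup) :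
    (inversions b u).ncard = length b u := by
  induction u using weylGroup_induction b with
  | one => simp [inversions_one, length_one]
  | step i hi w h ih =>
    have hw := (lt_length_ofIdx_mul_iff (Base.isPos_of_mem_support hi)).1 h
    rw [inversions_ofIdx_mul hi hw,
      Set.ncard_insert_of_notMem (notMem_image_inversions hi) (Set.toFinite _),
      Set.ncard_image_of_injective _ (MulAction.injective _), ih]
    have := length_ofIdx_mul w hi
    omega

/-! ### The strong Bruhat order -/

theorem BruhatLE.refl (b : P.Base) (u : P.weylGroup) : BruhatLE b u u := Relation.ReflTransGen.refl

theorem BruhatLE.trans {u v w : P.weylGroup} (h : BruhatLE b u v) (h' : BruhatLE b v w) :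
    BruhatLE b u w := Relation.ReflTransGen.trans h h'

theorem BruhatLE.eq_or_length_lt {u v : P.weylGroup} (h : BruhatLE b u v) :
    u = v ∨ length b u < length b v := by
  induction h with
  | refl => exact .inl rfl
  | tail _ h ih =>
    rcases ih with rfl | ih
    · exact .inr h.2
    · exact .inr (ih.trans h.2)

theorem BruhatLE.length_le {u v : P.weylGroup} (h : BruhatLE b u v) :
    length b u ≤ length b v := by
  rcases h.eq_or_length_lt with rfl | h
  exacts [le_rfl, h.le]

theorem bruhatLE_ofIdx_mul {u : P.weylGroup} {i : ι} (h : length b u < length b (ofIdx P i * u)) :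
    BruhatLE b u (ofIdx P i * u) := by
  refine Relation.ReflTransGen.single ⟨⟨u⁻¹ • i, ?_⟩, h⟩
  rw [mul_ofIdx_eq, smul_inv_smul]

/-- The lifting property. -/
theorem BruhatLE.lift {x y : P.weylGroup} (h : BruhatLE b x y) {k : ι} (hk : k ∈ b.support) :
    BruhatLE b x (ofIdx P k * y) ∨ BruhatLE b (ofIdx P k * x) (ofIdx P k * y) := by
  induction h with
  | refl => exact .inr (.refl b _)
  | @tail y z hxy h ih =>
    obtain ⟨⟨i, rfl⟩, hlt⟩ := h
    wlog hi : b.IsPos i generalizing i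
    · have := this (ofIdx P i • i)
      rw [ofIdx_ofIdx_smul_self] at this
      exact this hlt ((isPos_ofIdx_smul_self b i).2 hi)
    rw [lt_length_mul_ofIdx_iff hi] at hlt
    -- The positive root `y • i` stays positive under `s_k` unless it is `α_k`, and then `s_k y s_i
    -- = y`.
    by_cases hik : y • i = k
    · left
      rw [mul_ofIdx_eq, hik, ofIdx_mul_cancel_left]
      exact hxy
    · have hstep : BruhatLE b (ofIdx P k * y) (ofIdx P k * (y * ofIdx P i)) := by
        refine Relation.ReflTransGen.single ⟨⟨i, (mul_assoc _ _ _).symm⟩, ?_⟩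
        rw [← mul_assoc]
        refine lt_length_mul_ofIdx hi ?_
        rw [mul_smul]
        exact isPos_ofIdx_smul hk hlt hik
      exact ih.imp (·.trans hstep) (·.trans hstep)

/-! ### The left weak order -/

theorem leftWeakLE_iff {v u : P.weylGroup} :
    LeftWeakLE b v u ↔ length b (u * v⁻¹) + length b v = length b u := by
  unfold LeftWeakLE
  omega

theorem LeftWeakLE.refl (b : P.Base) (u : P.weylGroup) : LeftWeakLE b u u := by
  simp [LeftWeakLE, length_one]

/-- For a left descent `i` of `u`, the elements of the left weak interval of `s_i u` are those `v`
below `u` for which `i` is a left descent of `u v⁻¹`. -/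
theorem leftWeakLE_ofIdx_mul_iff {u v : P.weylGroup} {i : ι} (hi : i ∈ b.support) :
    (length b (ofIdx P i * u) < length b u ∧ LeftWeakLE b v (ofIdx P i * u)) ↔
      LeftWeakLE b v u ∧ length b (ofIdx P i * (u * v⁻¹)) < length b (u * v⁻¹) := by
  have h₁ := length_ofIdx_mul u hi
  have h₂ := length_ofIdx_mul (u * v⁻¹) hi
  have h₃ := length_mul_le b (u * v⁻¹) v
  have h₄ := length_mul_le b (ofIdx P i * (u * v⁻¹)) v
  rw [inv_mul_cancel_right] at h₃
  rw [mul_assoc, inv_mul_cancel_right] at h₄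
  rw [leftWeakLE_iff, leftWeakLE_iff, mul_assoc]
  omega

end Crystallographic

section SymmetricAlgebra

variable {V : Type*} [AddCommGroup V] [Module ℝ V]

/-! ### Divisibility by linear forms in a symmetric algebra -/

/-- A basis identifies the range of `ι` with the linear forms, whose powers are the homogeneous
submodules. -/
theorem mem_symDegree_iff_isHomogeneous {κ : Type*} (B : Module.Basis κ ℝ V) {d : ℕ} {p : SymmetricAlgebra ℝ V} :
    p ∈ symDegree V d ↔ (SymmetricAlgebra.equivMvPolynomial B p).IsHomogeneous d := by
  have h : (LinearMap.range (SymmetricAlgebra.ι ℝ V)).map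
      (SymmetricAlgebra.equivMvPolynomial B).toAlgHom.toLinearMap
        = MvPolynomial.homogeneousSubmodule κ ℝ 1 := by
    rw [MvPolynomial.homogeneousSubmodule_one_eq_span_X, ← LinearMap.range_comp,
      LinearMap.range_eq_map, ← B.span_eq, Submodule.map_span, ← Set.range_comp]
    congr 2
    funext i
    exact SymmetricAlgebra.equivMvPolynomial_ι_apply B i
  rw [← MvPolynomial.mem_homogeneousSubmodule, ← MvPolynomial.homogeneousSubmodule_one_pow, ← h,
    ← Submodule.map_pow]
  refine ⟨fun hp => Submodule.mem_map_of_mem hp, ?_⟩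
  rintro ⟨q, hq, hqp⟩
  rwa [← (SymmetricAlgebra.equivMvPolynomial B).injective hqp]

instance isDomain_symmetricAlgebra : IsDomain (SymmetricAlgebra ℝ V) :=
  (SymmetricAlgebra.equivMvPolynomial (Module.Free.chooseBasis ℝ V)).toMulEquiv.isDomain _

theorem exists_basis_apply_eq {V : Type u} [AddCommGroup V] [Module ℝ V] {x : V} (hx : x ≠ 0) :
    ∃ (κ : Type u) (B : Module.Basis κ ℝ V) (i : κ), B i = x := by
  have h : LinearIndepOn ℝ id ({x} : Set V) := LinearIndepOn.singleton hx
  exact ⟨_, Module.Basis.extend h, ⟨x, Module.Basis.subset_extend h rfl⟩, by simp⟩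

/-- A nonzero vector extends to a basis, in which it becomes a polynomial variable. -/
theorem prime_ι {x : V} (hx : x ≠ 0) : Prime (SymmetricAlgebra.ι ℝ V x) := by
  obtain ⟨κ, B, i, rfl⟩ := exists_basis_apply_eq hx
  rw [← MulEquiv.prime_iff (SymmetricAlgebra.equivMvPolynomial B).toMulEquiv]
  have := SymmetricAlgebra.equivMvPolynomial_ι_apply B i
  exact this ▸ MvPolynomial.X_prime

/-- Otherwise some functional kills `x` but not `y`; it extends to an algebra map to `ℝ`,
contradicting divisibility. -/
theorem mem_span_singleton_of_ι_dvd_ι {x y : V}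
    (h : SymmetricAlgebra.ι ℝ V x ∣ SymmetricAlgebra.ι ℝ V y) : ∃ c : ℝ, y = c • x := by
  obtain ⟨q, hq⟩ := h
  by_contra hy
  obtain ⟨f, hf, hf'⟩ := Submodule.exists_le_ker_of_notMem
    (p := Submodule.span ℝ {x}) (v := y) (by
      rw [Submodule.mem_span_singleton]
      rintro ⟨c, rfl⟩
      exact hy ⟨c, rfl⟩)
  have hfx : f x = 0 := hf' (Submodule.mem_span_singleton_self x)
  have := congrArg (SymmetricAlgebra.lift f) hq
  rw [map_mul, SymmetricAlgebra.lift_ι_apply, SymmetricAlgebra.lift_ι_apply, hfx, zero_mul] at this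
  exact hf this

/-- Multiplying by a variable only shifts exponents. Writing `d = e + 1` avoids truncated
subtraction and records that `d` is positive. -/
theorem exists_of_ι_mul_mem_symDegree {x : V} (hx : x ≠ 0) {q : SymmetricAlgebra ℝ V} (hq : q ≠ 0) {d : ℕ}
    (h : SymmetricAlgebra.ι ℝ V x * q ∈ symDegree V d) : ∃ e, d = e + 1 ∧ q ∈ symDegree V e := by
  obtain ⟨κ, B, i, rfl⟩ := exists_basis_apply_eq hx
  simp only [mem_symDegree_iff_isHomogeneous B, map_mul,
    SymmetricAlgebra.equivMvPolynomial_ι_apply] at h ⊢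
  have hq' : SymmetricAlgebra.equivMvPolynomial B q ≠ 0 := by simpa using hq
  have key : ∀ m, MvPolynomial.coeff m (SymmetricAlgebra.equivMvPolynomial B q) ≠ 0 →
      m.degree + 1 = d := fun m hm => by
    by_contra hd
    have := h.coeff_eq_zero (d := Finsupp.single i 1 + m) (by simpa [add_comm] using hd)
    rw [MvPolynomial.coeff_X_mul] at this
    exact hm this
  obtain ⟨m, hm⟩ := MvPolynomial.exists_coeff_ne_zero hq'
  refine ⟨m.degree, (key m hm).symm, fun n hn => ?_⟩
  have := key n hn
  have := key m hm
  refine (DFunLike.congr_fun Finsupp.degree_eq_weight_one n).symm.trans ?_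
  omega

theorem ι_mem_symDegree (x : V) : SymmetricAlgebra.ι ℝ V x ∈ symDegree V 1 := by
  simp [symDegree]

theorem mul_mem_symDegree {p q : SymmetricAlgebra ℝ V} {d e : ℕ} (hp : p ∈ symDegree V d) (hq : q ∈ symDegree V e) :
    p * q ∈ symDegree V (d + e) := by
  rw [symDegree, pow_add]
  exact Submodule.mul_mem_mul hp hq

theorem prod_ι_mem_symDegree {κ : Type*} (s : Finset κ) (x : κ → V) :
    ∏ i ∈ s, SymmetricAlgebra.ι ℝ V (x i) ∈ symDegree V s.card := by
  classical
  induction s using Finset.induction_on with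
  | empty => simp [symDegree, Submodule.one_le.1 le_rfl]
  | insert i s hi ih =>
    rw [Finset.prod_insert hi, Finset.card_insert_of_notMem hi, add_comm]
    exact mul_mem_symDegree (ι_mem_symDegree _) ih

theorem card_le_of_prod_ι_mul_mem_symDegree {κ : Type*} {s : Finset κ} {x : κ → V}
    (hx : ∀ i ∈ s, x i ≠ 0) {q : SymmetricAlgebra ℝ V} (hq : q ≠ 0) {d : ℕ}
    (h : (∏ i ∈ s, SymmetricAlgebra.ι ℝ V (x i)) * q ∈ symDegree V d) : s.card ≤ d := by
  classical
  induction s using Finset.induction_on generalizing d with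
  | empty => simp
  | insert i s hi ih =>
    rw [Finset.prod_insert hi, mul_assoc] at h
    have hs : ∀ j ∈ s, x j ≠ 0 := fun j hj => hx j (Finset.mem_insert_of_mem hj)
    obtain ⟨e, rfl, he⟩ := exists_of_ι_mul_mem_symDegree (hx i (Finset.mem_insert_self i s))
      (mul_ne_zero (Finset.prod_ne_zero_iff.2 fun j hj => (prime_ι (hs j hj)).ne_zero) hq) h
    rw [Finset.card_insert_of_notMem hi]
    exact Nat.succ_le_succ (ih hs he)

end SymmetricAlgebra

/-! ### The action of the Weyl group on the symmetric algebra -/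

@[simp]
theorem symAct_ι (w : P.weylGroup) (x : M) :
    symAct w (SymmetricAlgebra.ι ℝ M x) = SymmetricAlgebra.ι ℝ M (w • x) :=
  SymmetricAlgebra.lift_ι_apply _ _

theorem symAct_mul (v w : P.weylGroup) (p : SymmetricAlgebra ℝ M) :
    symAct (v * w) p = symAct v (symAct w p) := by
  have : symAct (v * w) = (symAct v).comp (symAct w) :=
    SymmetricAlgebra.algHom_ext <| LinearMap.ext fun x => by simp [mul_smul]
  rw [this, AlgHom.comp_apply]

@[simp]
theorem symAct_one (p : SymmetricAlgebra ℝ M) : symAct (1 : P.weylGroup) p = p := by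
  have : symAct (1 : P.weylGroup) = AlgHom.id ℝ _ :=
    SymmetricAlgebra.algHom_ext <| LinearMap.ext fun x => by simp
  rw [this, AlgHom.id_apply]

@[simp]
theorem symAct_ofIdx_ofIdx (i : ι) (p : SymmetricAlgebra ℝ M) :
    symAct (ofIdx P i) (symAct (ofIdx P i) p) = p := by
  rw [← symAct_mul, ofIdx_mul_self, symAct_one]

theorem symAct_mem_symDegree (w : P.weylGroup) {p : SymmetricAlgebra ℝ M} {d : ℕ}
    (hp : p ∈ symDegree M d) : symAct w p ∈ symDegree M d := by
  have h : (LinearMap.range (SymmetricAlgebra.ι ℝ M)).map (symAct w).toLinearMap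
      ≤ LinearMap.range (SymmetricAlgebra.ι ℝ M) := by
    rintro _ ⟨_, ⟨x, rfl⟩, rfl⟩
    exact ⟨w • x, (symAct_ι w x).symm⟩
  have h' := Submodule.mem_map_of_mem (f := (symAct w).toLinearMap) hp
  rw [symDegree, Submodule.map_pow] at h'
  exact pow_le_pow_left' h d h'

/-- True on generators by the reflection formula; a twisted Leibniz rule handles products. -/
theorem ι_root_dvd_sub_symAct (i : ι) (p : SymmetricAlgebra ℝ M) :
    SymmetricAlgebra.ι ℝ M (P.root i) ∣ p - symAct (ofIdx P i) p := by
  induction p using SymmetricAlgebra.induction with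
  | algebraMap r => simp
  | ι x =>
    rw [symAct_ι, ofIdx_smul_weight, reflection_apply, map_sub, sub_sub_cancel, map_smul]
    exact dvd_smul_of_dvd _ dvd_rfl
  | mul p q hp hq =>
    have : p * q - symAct (ofIdx P i) (p * q)
        = (p - symAct (ofIdx P i) p) * q
          + symAct (ofIdx P i) p * (q - symAct (ofIdx P i) q) := by
      rw [map_mul]; ring
    rw [this]
    exact dvd_add (hp.mul_right _) (hq.mul_left _)
  | add p q hp hq =>
    rw [map_add, add_sub_add_comm]
    exact dvd_add hp hq

/-! ### Permuted functions -/

@[simp]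
theorem permute_one (f : P.weylGroup → SymmetricAlgebra ℝ M) : permute 1 f = f := by
  funext v
  simp [permute]

theorem permute_mul (v w : P.weylGroup) (f : P.weylGroup → SymmetricAlgebra ℝ M) :
    permute (v * w) f = permute w (permute v f) := by
  funext x
  simp only [permute, mul_inv_rev, symAct_mul, mul_assoc]

theorem permute_zero (w : P.weylGroup) :
    permute w (0 : P.weylGroup → SymmetricAlgebra ℝ M) = 0 := by
  funext v
  simp [permute]

theorem permute_sum_smul (w : P.weylGroup) {κ : Type*} (s : Finset κ)
    (p : κ → SymmetricAlgebra ℝ M) (f : κ → P.weylGroup → SymmetricAlgebra ℝ M) :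
    permute w (∑ i ∈ s, p i • f i) = ∑ i ∈ s, symAct w⁻¹ (p i) • permute w (f i) := by
  funext v
  simp [permute, Finset.sum_apply]

theorem permute_ofIdx_apply (i : ι) (f : P.weylGroup → SymmetricAlgebra ℝ M) (v : P.weylGroup) :
    permute (ofIdx P i) f v = symAct (ofIdx P i) (f (ofIdx P i * v)) := by
  simp [permute]

/-! ### The divisibility conditions -/

theorem eq_or_eq_ofIdx_smul_of_ι_root_dvd [P.IsReduced] {i j : ι}
    (h : SymmetricAlgebra.ι ℝ M (P.root j) ∣ SymmetricAlgebra.ι ℝ M (P.root i)) :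
    j = i ∨ j = ofIdx P i • i := by
  obtain ⟨c, hc⟩ := mem_span_singleton_of_ι_dvd_ι h
  have hli : ¬ LinearIndependent ℝ ![P.root j, P.root i] := fun hli => by
    have := (LinearIndependent.pair_iff.1 hli (-c) 1 (by rw [hc]; module)).2
    exact one_ne_zero this
  rcases IsReduced.eq_or_eq_neg j i hli with h | h
  · exact .inl (P.root.injective h)
  · exact .inr (P.root.injective (by rw [h, ofIdx_smul_root_self]))

theorem ofIdx_smul_root_dvd_iff (i : ι) (p : SymmetricAlgebra ℝ M) :
    SymmetricAlgebra.ι ℝ M (P.root (ofIdx P i • i)) ∣ p ↔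
      SymmetricAlgebra.ι ℝ M (P.root i) ∣ p := by
  rw [ofIdx_smul_root_self, map_neg, neg_dvd]

/-- Since `w s_β = s_{wβ} w`, the divisor is the root of the reflection on the left. Positivity is
no restriction: opposite roots share a reflection and differ as divisors by a sign. -/
theorem mem_cohomology_iff {b : P.Base} {f : P.weylGroup → SymmetricAlgebra ℝ M} :
    f ∈ cohomology b ↔ ∀ (j : ι) (v : P.weylGroup),
      SymmetricAlgebra.ι ℝ M (P.root j) ∣ f (ofIdx P j * v) - f v := by
  constructor
  · intro h j v
    by_cases hj : b.IsPos (v⁻¹ • j)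
    · have := h v (v⁻¹ • j) hj
      rwa [mul_ofIdx_eq, ← root_smul, smul_inv_smul] at this
    · have := h v (ofIdx P (v⁻¹ • j) • v⁻¹ • j) ((isPos_ofIdx_smul_self b _).2 hj)
      rwa [ofIdx_ofIdx_smul_self, ← root_smul, ← mul_smul, mul_ofIdx_eq, mul_smul, smul_inv_smul,
        ofIdx_smul_root_dvd_iff] at this
  · intro h v i _
    have := h (v • i) v
    rwa [← mul_ofIdx_eq, root_smul] at this

/-- The left divided difference of a class with respect to a root. -/
theorem exists_divided_difference [P.IsReduced] {b : P.Base}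
    {f : P.weylGroup → SymmetricAlgebra ℝ M} (hf : f ∈ cohomology b) (i : ι) :
    ∃ g ∈ cohomology b, f - permute (ofIdx P i) f = SymmetricAlgebra.ι ℝ M (P.root i) • g := by
  rw [mem_cohomology_iff] at hf
  have hdvd : ∀ v, SymmetricAlgebra.ι ℝ M (P.root i) ∣ f v - permute (ofIdx P i) f v := fun v => by
    have h₁ := dvd_sub_comm.1 (hf i v)
    have h₂ := ι_root_dvd_sub_symAct (P := P) i (f (ofIdx P i * v))
    have := dvd_add h₁ h₂
    rwa [sub_add_sub_cancel, ← permute_ofIdx_apply] at this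
  choose g hg using hdvd
  have hi0 : SymmetricAlgebra.ι ℝ M (P.root i) ≠ 0 := (prime_ι (P.ne_zero i)).ne_zero
  refine ⟨g, mem_cohomology_iff.2 fun j v => ?_, funext hg⟩
  -- If `α_j = ±α_i`, the condition follows from `g (s_i v) = s_i (g v)`. Otherwise `α_j` is a prime
  -- not dividing `α_i`, so it suffices to test `α_i g`.
  by_cases hj : SymmetricAlgebra.ι ℝ M (P.root j) ∣ SymmetricAlgebra.ι ℝ M (P.root i)
  · have hself : SymmetricAlgebra.ι ℝ M (P.root i) ∣ g (ofIdx P i * v) - g v := by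
      have : g (ofIdx P i * v) = symAct (ofIdx P i) (g v) := by
        apply mul_left_cancel₀ hi0
        have h := congrArg (symAct (ofIdx P i)) (hg v)
        rw [map_mul, symAct_ι, ← root_smul, ofIdx_smul_root_self, map_neg, map_sub,
          permute_ofIdx_apply, symAct_ofIdx_ofIdx] at h
        rw [← hg, permute_ofIdx_apply, ofIdx_mul_cancel_left]
        linear_combination -h
      rw [this, dvd_sub_comm]
      exact ι_root_dvd_sub_symAct i (g v)
    rcases eq_or_eq_ofIdx_smul_of_ι_root_dvd hj with rfl | rfl
    · exact hself
    · rwa [ofIdx_smul_root_dvd_iff, ofIdx_ofIdx_smul_self]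
  · refine ((prime_ι (P.ne_zero j)).dvd_or_dvd ?_).resolve_left hj
    have h₁ := hf j v
    -- This is the divisibility condition for the permuted class at `j` and `v`.
    have h₂ := map_dvd (symAct (ofIdx P i)) (hf (ofIdx P i • j) (ofIdx P i * v))
    rw [symAct_ι, ← root_smul, ofIdx_smul_smul, ← mul_assoc, ← mul_ofIdx_eq, mul_assoc, map_sub,
      ← permute_ofIdx_apply, ← permute_ofIdx_apply] at h₂
    rw [mul_sub, ← hg, ← hg]
    convert dvd_sub h₁ h₂ using 1
    ring

section Crystallographic

variable [Finite ι] [P.IsCrystallographic] [P.IsReduced] {b : P.Base}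

/-! ### Vanishing -/

/-- The product of the inversions of `u⁻¹`. -/
noncomputable def inversionProd (b : P.Base) (u : P.weylGroup) : SymmetricAlgebra ℝ M :=
  ∏ i ∈ (Set.toFinite (inversions b u)).toFinset, SymmetricAlgebra.ι ℝ M (P.root i)

theorem finprod_eq_inversionProd (b : P.Base) (u : P.weylGroup) :
    ∏ᶠ (i : ι) (_ : b.IsPos i ∧ ¬ b.IsPos (u⁻¹ • i)), SymmetricAlgebra.ι ℝ M (P.root i)
      = inversionProd b u :=
  finprod_mem_eq_finite_toFinset_prod _ (Set.toFinite (inversions b u))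

theorem card_inversions (b : P.Base) (u : P.weylGroup) :
    (Set.toFinite (inversions b u)).toFinset.card = length b u := by
  rw [← ncard_inversions, Set.ncard_eq_toFinset_card]

theorem inversionProd_ne_zero (b : P.Base) (u : P.weylGroup) : inversionProd b u ≠ 0 :=
  Finset.prod_ne_zero_iff.2 fun i _ => (prime_ι (P.ne_zero i)).ne_zero

theorem inversionProd_mem_symDegree (b : P.Base) (u : P.weylGroup) :
    inversionProd b u ∈ symDegree M (length b u) := by
  rw [← card_inversions]
  exact prod_ι_mem_symDegree _ _

theorem inversionProd_one (b : P.Base) : inversionProd b (1 : P.weylGroup) = 1 := by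
  simp [inversionProd, inversions_one]

theorem inversionProd_ofIdx_mul {u : P.weylGroup} {i : ι} (hi : i ∈ b.support)
    (h : length b u < length b (ofIdx P i * u)) :
    inversionProd b (ofIdx P i * u)
      = SymmetricAlgebra.ι ℝ M (P.root i) * symAct (ofIdx P i) (inversionProd b u) := by
  rw [lt_length_ofIdx_mul_iff (Base.isPos_of_mem_support hi)] at h
  have hinv := inversions_ofIdx_mul hi h
  rw [← finprod_eq_inversionProd, ← finprod_eq_inversionProd]
  change ∏ᶠ (j : ι) (_ : j ∈ inversions b (ofIdx P i * u)), _
    = _ * symAct _ (∏ᶠ (j : ι) (_ : j ∈ inversions b u), _)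
  rw [hinv, finprod_mem_insert _ (notMem_image_inversions hi) (Set.toFinite _),
    finprod_mem_image (MulAction.injective _).injOn,
    finprod_mem_eq_finite_toFinset_prod _ (Set.toFinite (inversions b u)),
    finprod_mem_eq_finite_toFinset_prod _ (Set.toFinite (inversions b u)), map_prod]
  simp only [symAct_ι, root_smul]

/-- Distinct positive roots are pairwise non-associated primes, by reducedness. -/
theorem prod_ι_root_dvd {s : Finset ι} (hs : ∀ i ∈ s, b.IsPos i) {p : SymmetricAlgebra ℝ M}
    (h : ∀ i ∈ s, SymmetricAlgebra.ι ℝ M (P.root i) ∣ p) :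
    ∏ i ∈ s, SymmetricAlgebra.ι ℝ M (P.root i) ∣ p := by
  classical
  induction s using Finset.induction_on with
  | empty => simp
  | insert i s hi ih =>
    obtain ⟨q, rfl⟩ := ih (fun j hj => hs j (Finset.mem_insert_of_mem hj))
      fun j hj => h j (Finset.mem_insert_of_mem hj)
    rw [Finset.prod_insert hi, mul_comm]
    refine mul_dvd_mul_left _ (((prime_ι (P.ne_zero i)).dvd_or_dvd
      (h i (Finset.mem_insert_self i s))).resolve_left fun hdvd => ?_)
    obtain ⟨j, hj, hij⟩ := (prime_ι (P.ne_zero i)).exists_mem_finset_dvd hdvd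
    rcases eq_or_eq_ofIdx_smul_of_ι_root_dvd hij with rfl | rfl
    · exact hi hj
    · exact (isPos_ofIdx_smul_self b j).1 (hs _ (Finset.mem_insert_self _ s))
        (hs j (Finset.mem_insert_of_mem hj))

/-- For an inversion `i` of `v`, `s_i v` is shorter, so `f` vanishes there and the root divides `f
v`. -/
theorem inversionProd_dvd {f : P.weylGroup → SymmetricAlgebra ℝ M} (hf : f ∈ cohomology b)
    {v : P.weylGroup} (h : ∀ v', length b v' < length b v → f v' = 0) :
    inversionProd b v ∣ f v := by
  refine prod_ι_root_dvd (b := b) (fun i hi => ((Set.Finite.mem_toFinset _).1 hi).1)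
    fun i hi => ?_
  obtain ⟨hi₁, hi₂⟩ := (Set.Finite.mem_toFinset _).1 hi
  have := mem_cohomology_iff.1 hf i v
  rwa [h _ (length_ofIdx_mul_lt hi₁ hi₂), zero_sub, dvd_neg] at this

/-- A class whose values have degree less than the length of the argument vanishes. -/
theorem eq_zero_of_degree_lt_length {f : P.weylGroup → SymmetricAlgebra ℝ M}
    (hf : f ∈ cohomology b)
    (h : ∀ v, f v ≠ 0 → ∃ d < length b v, f v ∈ symDegree M d) : f = 0 := by
  funext v
  induction hn : length b v using Nat.strong_induction_on generalizing v with
  | _ n ih =>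
    subst hn
    by_contra hv
    obtain ⟨q, hq⟩ := inversionProd_dvd hf fun v' hv' => ih _ hv' v' rfl
    obtain ⟨d, hd, hdeg⟩ := h v hv
    rw [hq, inversionProd] at hdeg
    have hq0 : q ≠ 0 := by
      rintro rfl
      exact hv (by simpa using hq)
    have := card_le_of_prod_ι_mul_mem_symDegree (fun i _ => P.ne_zero i) hq0 hdeg
    rw [card_inversions] at this
    omega

/-! ### Schubert classes -/

theorem IsSchubertClass.apply_eq_inversionProd {u : P.weylGroup}
    {f : P.weylGroup → SymmetricAlgebra ℝ M} (hf : IsSchubertClass b u f) :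
    f u = inversionProd b u :=
  hf.apply_self.trans (finprod_eq_inversionProd b u)

theorem IsSchubertClass.eq_zero {u v : P.weylGroup} {f : P.weylGroup → SymmetricAlgebra ℝ M}
    (hf : IsSchubertClass b u f) (h : length b v ≤ length b u) (hne : u ≠ v) : f v = 0 := by
  by_contra hv
  exact ((hf.support v hv).eq_or_length_lt.resolve_left hne).not_ge h

/-- The difference has degree `ℓ(u)` but vanishes at all arguments of length at most `ℓ(u)`. -/
theorem IsSchubertClass.unique {u : P.weylGroup} {f g : P.weylGroup → SymmetricAlgebra ℝ M}
    (hf : IsSchubertClass b u f) (hg : IsSchubertClass b u g) : f = g := by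
  rw [← sub_eq_zero]
  refine eq_zero_of_degree_lt_length (sub_mem hf.mem_cohomology hg.mem_cohomology) fun v hv => ?_
  refine ⟨length b u, ?_, sub_mem (hf.homogeneous v) (hg.homogeneous v)⟩
  by_contra hlt
  by_cases huv : u = v
  · subst huv
    exact hv (by simp [hf.apply_self, hg.apply_self])
  · exact hv (by simp [hf.eq_zero (not_lt.1 hlt) huv, hg.eq_zero (not_lt.1 hlt) huv])

theorem exists_degree_of_divided_difference {f g : P.weylGroup → SymmetricAlgebra ℝ M} {i : ι}
    {d : ℕ} (hf : ∀ v, f v ∈ symDegree M d)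
    (h : f - permute (ofIdx P i) f = SymmetricAlgebra.ι ℝ M (P.root i) • g)
    {v : P.weylGroup} (hv : g v ≠ 0) : ∃ e, d = e + 1 ∧ g v ∈ symDegree M e := by
  refine exists_of_ι_mul_mem_symDegree (P.ne_zero i) hv ?_
  have := congrFun h v
  rw [Pi.smul_apply, smul_eq_mul] at this
  rw [← this, Pi.sub_apply, permute_ofIdx_apply]
  exact sub_mem (hf _) (symAct_mem_symDegree _ (hf _))

theorem ne_zero_or_ne_zero_of_divided_difference {f g : P.weylGroup → SymmetricAlgebra ℝ M} {i : ι}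
    (h : f - permute (ofIdx P i) f = SymmetricAlgebra.ι ℝ M (P.root i) • g)
    {v : P.weylGroup} (hv : g v ≠ 0) : f v ≠ 0 ∨ f (ofIdx P i * v) ≠ 0 := by
  by_contra! h0
  have := congrFun h v
  rw [Pi.sub_apply, permute_ofIdx_apply, h0.1, h0.2, map_zero, sub_zero, Pi.smul_apply,
    smul_eq_mul, eq_comm, mul_eq_zero] at this
  exact this.elim (prime_ι (P.ne_zero i)).ne_zero hv

/-- A left divided difference of a Schubert class at a left descent is a Schubert class. -/
theorem IsSchubertClass.divided_difference {u : P.weylGroup} {i : ι} (hi : i ∈ b.support)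
    (hlt : length b u < length b (ofIdx P i * u)) {f g : P.weylGroup → SymmetricAlgebra ℝ M}
    (hf : IsSchubertClass b (ofIdx P i * u) f) (hg : g ∈ cohomology b)
    (h : f - permute (ofIdx P i) f = SymmetricAlgebra.ι ℝ M (P.root i) • g) :
    IsSchubertClass b u g where
  mem_cohomology := hg
  homogeneous v := by
    by_cases hv : g v = 0
    · rw [hv]
      exact zero_mem _
    · obtain ⟨e, he, hev⟩ := exists_degree_of_divided_difference hf.homogeneous h hv
      have := length_ofIdx_mul u hi
      rwa [show length b u = e by omega]
  support v hv := by
    rcases ne_zero_or_ne_zero_of_divided_difference h hv with hv | hv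
    · exact (bruhatLE_ofIdx_mul hlt).trans (hf.support v hv)
    -- Lifting `s_i u ≼ s_i v` gives `s_i u ≼ v` or `u ≼ v`.
    · have := (hf.support _ hv).lift hi
      rw [ofIdx_mul_cancel_left, ofIdx_mul_cancel_left] at this
      exact this.elim (bruhatLE_ofIdx_mul hlt).trans id
  apply_self := by
    rw [finprod_eq_inversionProd]
    -- At `u` only the permuted term survives; its sign cancels against `s_i α_i = -α_i`.
    have h0 : f u = 0 := hf.eq_zero hlt.le fun h => hlt.ne' (congrArg _ h)
    have := congrFun h u
    rw [Pi.sub_apply, permute_ofIdx_apply, h0, hf.apply_eq_inversionProd,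
      inversionProd_ofIdx_mul hi hlt, map_mul, symAct_ofIdx_ofIdx, symAct_ι, ← root_smul,
      ofIdx_smul_root_self, map_neg, Pi.smul_apply, smul_eq_mul] at this
    apply mul_left_cancel₀ (prime_ι (P.ne_zero i)).ne_zero
    linear_combination -this

/-- A Schubert class is invariant under the simple reflections that are not left descents. -/
theorem IsSchubertClass.permute_ofIdx_eq_self {u : P.weylGroup} {i : ι} (hi : i ∈ b.support)
    (hlt : length b u < length b (ofIdx P i * u)) {f : P.weylGroup → SymmetricAlgebra ℝ M}
    (hf : IsSchubertClass b u f) : permute (ofIdx P i) f = f := by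
  obtain ⟨g, hg, h⟩ := exists_divided_difference hf.mem_cohomology i
  have hg0 : g = 0 := by
    refine eq_zero_of_degree_lt_length hg fun v hv => ?_
    obtain ⟨e, he, hev⟩ := exists_degree_of_divided_difference hf.homogeneous h hv
    refine ⟨e, ?_, hev⟩
    rcases ne_zero_or_ne_zero_of_divided_difference h hv with hv | hv
    · have := (hf.support v hv).length_le
      omega
    · have h₁ := length_ofIdx_mul v hi
      -- If `s_i v = u`, then `v = s_i u` is longer than `u`: this is where `hlt` matters.
      rcases (hf.support _ hv).eq_or_length_lt with h₂ | h₂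
      · have h₃ := congrArg (length b) h₂
        rw [h₂, ofIdx_mul_cancel_left] at hlt
        omega
      · omega
  rw [hg0, smul_zero, sub_eq_zero] at h
  exact h.symm

end Crystallographic

section Existence
variable [Finite ι] [P.IsCrystallographic] [P.IsReduced] {b : P.Base}

/-! ### Existence of Schubert classes -/

/-- If every simple reflection is a left descent of `u`, the class of `u` is concentrated at `u`. -/
theorem isSchubertClass_single {u : P.weylGroup}
    (hu : ∀ i ∈ b.support, ¬ b.IsPos (u⁻¹ • i)) :
    IsSchubertClass b u (Pi.single u (inversionProd b u)) := by
  -- By additivity `u⁻¹` makes every positive root negative, so the value at `u` is divisible by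
  -- every root.
  have hneg : ∀ {i : ι}, b.IsPos i → ¬ b.IsPos (u⁻¹ • i) := fun {i} hi => by
    refine hi.induction_on_add hu fun i j k hk h₁ hj => ?_
    have h₂ := hu j hj
    rw [← isPos_ofIdx_smul_self] at h₁ h₂ ⊢
    refine h₁.add h₂ ?_
    rw [ofIdx_smul_root_self, ofIdx_smul_root_self, ofIdx_smul_root_self, root_smul, root_smul,
      root_smul, hk, smul_add, neg_add]
  have hdvd : ∀ j v, SymmetricAlgebra.ι ℝ M (P.root j) ∣
      (Pi.single u (inversionProd b u) : P.weylGroup → SymmetricAlgebra ℝ M) v := fun j v => by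
    by_cases hv : v = u
    · subst hv
      rw [Pi.single_eq_same]
      have key : ∀ {i}, b.IsPos i →
          SymmetricAlgebra.ι ℝ M (P.root i) ∣ inversionProd b v := fun hi =>
        Finset.dvd_prod_of_mem (fun i => SymmetricAlgebra.ι ℝ M (P.root i))
          ((Set.Finite.mem_toFinset _).2 ⟨hi, hneg hi⟩)
      by_cases hj : b.IsPos j
      · exact key hj
      · exact (ofIdx_smul_root_dvd_iff j _).1 (key ((isPos_ofIdx_smul_self b j).2 hj))
    · rw [Pi.single_eq_of_ne hv]
      exact dvd_zero _
  refine ⟨mem_cohomology_iff.2 fun j v => dvd_sub (hdvd j _) (hdvd j _), fun v => ?_,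
    fun v hv => ?_, ?_⟩
  · by_cases hv : v = u
    · subst hv
      rw [Pi.single_eq_same]
      exact inversionProd_mem_symDegree b v
    · rw [Pi.single_eq_of_ne hv]
      exact zero_mem _
  · by_cases h : v = u
    · rw [h]
      exact .refl b u
    · exact absurd (Pi.single_eq_of_ne h _) hv
  · rw [Pi.single_eq_same, finprod_eq_inversionProd]

theorem exists_length_le [P.IsRootSystem] (b : P.Base) : ∃ n, ∀ w : P.weylGroup, length b w ≤ n :=
  ⟨Finset.univ.sup (length b), fun w => Finset.le_sup (Finset.mem_univ w)⟩

theorem exists_isSchubertClass [P.IsRootSystem] (b : P.Base) (u : P.weylGroup) :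
    ∃ f, IsSchubertClass b u f := by
  obtain ⟨n, hn⟩ := exists_length_le b
  -- Descending induction on the length, which is bounded because the group is finite.
  induction hk : n - length b u using Nat.strong_induction_on generalizing u with
  | _ k ih =>
    by_cases hu : ∀ i ∈ b.support, ¬ b.IsPos (u⁻¹ • i)
    · exact ⟨_, isSchubertClass_single hu⟩
    · push Not at hu
      obtain ⟨i, hi, hpos⟩ := hu
      have hlt := (lt_length_ofIdx_mul_iff (Base.isPos_of_mem_support hi)).2 hpos
      have := hn (ofIdx P i * u)
      obtain ⟨f, hf⟩ := ih _ (by omega) (ofIdx P i * u) rfl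
      obtain ⟨g, hg, h⟩ := exists_divided_difference hf.mem_cohomology i
      exact ⟨g, hf.divided_difference hi hlt hg h⟩

theorem bruhatLE_one (b : P.Base) (v : P.weylGroup) : BruhatLE b 1 v := by
  induction v using weylGroup_induction b with
  | one => exact .refl b 1
  | step i _ w h ih => exact ih.trans (bruhatLE_ofIdx_mul h)

theorem isSchubertClass_one (b : P.Base) :
    IsSchubertClass b (1 : P.weylGroup) (1 : P.weylGroup → SymmetricAlgebra ℝ M) where
  mem_cohomology := one_mem _
  homogeneous v := by
    rw [length_one, symDegree, pow_zero]
    exact Submodule.one_le.1 le_rfl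
  support v _ := bruhatLE_one b v
  apply_self := by rw [finprod_eq_inversionProd, inversionProd_one, Pi.one_apply]

/-! ### Recursion -/

theorem ite_sum_zero {κ A : Type*} [AddCommMonoid A] (p : Prop) [Decidable p] (s : Finset κ)
    (f : κ → A) : (if p then ∑ c ∈ s, f c else 0) = ∑ c ∈ s, if p then f c else 0 := by
  split_ifs <;> simp

theorem ofIdx_mul_leftWeakLE_iff {u v : P.weylGroup} {i : ι} (hi : i ∈ b.support) :
    (LeftWeakLE b (ofIdx P i * v) u ∧ length b v < length b (ofIdx P i * v)) ↔
      LeftWeakLE b v u ∧ length b (ofIdx P i * (v * u⁻¹)) < length b (v * u⁻¹) := by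
  have h₁ := length_ofIdx_mul v hi
  have h₂ := length_ofIdx_mul (v * u⁻¹) hi
  have h₃ := length_mul_le b (u * v⁻¹) v
  have h₄ := length_mul_le b (u * (ofIdx P i * v)⁻¹) (ofIdx P i * v)
  rw [inv_mul_cancel_right] at h₃ h₄
  have h₅ := length_inv b (u * v⁻¹)
  have h₆ := length_inv b (u * (ofIdx P i * v)⁻¹)
  rw [mul_inv_rev, inv_inv] at h₅ h₆
  rw [mul_assoc] at h₆
  rw [leftWeakLE_iff, leftWeakLE_iff]
  omega

section Recursion

variable {τ : P.weylGroup → P.weylGroup → SymmetricAlgebra ℝ M}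
  (hτ : ∀ u, IsSchubertClass b u (τ u))
include hτ

theorem schubert_one : τ 1 = 1 := (hτ 1).unique (isSchubertClass_one b)

theorem schubert_apply_one (u : P.weylGroup) : τ u 1 = if u = 1 then 1 else 0 := by
  split_ifs with h
  · rw [h, schubert_one hτ, Pi.one_apply]
  · exact (hτ u).eq_zero (by rw [length_one]; exact Nat.zero_le _) h

theorem permute_ofIdx_schubert (u : P.weylGroup) {i : ι} (hi : i ∈ b.support) :
    permute (ofIdx P i) (τ u) = τ u - if length b (ofIdx P i * u) < length b u then
      SymmetricAlgebra.ι ℝ M (P.root i) • τ (ofIdx P i * u) else 0 := by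
  split_ifs with h
  · obtain ⟨g, hg, hgu⟩ := exists_divided_difference (hτ u).mem_cohomology i
    have hu : ofIdx P i * (ofIdx P i * u) = u := ofIdx_mul_cancel_left i u
    have hS := (hu.symm ▸ hτ u : IsSchubertClass b (ofIdx P i * (ofIdx P i * u)) (τ u))
    rw [(hτ (ofIdx P i * u)).unique (hS.divided_difference hi (by rwa [hu]) hg hgu), ← hgu,
      sub_sub_cancel]
  · rw [sub_zero]
    have := length_ofIdx_mul u hi
    exact (hτ u).permute_ofIdx_eq_self hi (by omega)

/-- Here `τ_{s_i u}` may be replaced by its permuted form, as `s_i` is not a descent of `s_i u`;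
every term on the right is then permuted. -/
theorem schubert_eq_permute_ofIdx (u : P.weylGroup) {i : ι} (hi : i ∈ b.support) :
    τ u = permute (ofIdx P i) (τ u) + if length b (ofIdx P i * u) < length b u then
      SymmetricAlgebra.ι ℝ M (P.root i) • permute (ofIdx P i) (τ (ofIdx P i * u)) else 0 := by
  rw [permute_ofIdx_schubert hτ u hi]
  split_ifs with h
  · rw [(hτ (ofIdx P i * u)).permute_ofIdx_eq_self hi (by rwa [ofIdx_mul_cancel_left]),
      sub_add_cancel]
  · rw [sub_zero, add_zero]

theorem schubert_apply_ofIdx_mul (u x : P.weylGroup) {i : ι} (hi : i ∈ b.support) :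
    τ u (ofIdx P i * x) = symAct (ofIdx P i) (τ u x) +
      if length b (ofIdx P i * u) < length b u then
        SymmetricAlgebra.ι ℝ M (P.root i) * symAct (ofIdx P i) (τ (ofIdx P i * u) x) else 0 := by
  conv_lhs => rw [schubert_eq_permute_ofIdx hτ u hi]
  split_ifs with h <;> simp [permute_ofIdx_apply]

variable [P.IsRootSystem]

/-! ### The transition formulas -/

/-- Written with `x = w⁻¹`, so that the induction prepends simple reflections to the argument. -/
theorem schubert_eq_sum_permute (x a : P.weylGroup) :
    τ a = ∑ c : P.weylGroup with LeftWeakLE b c a, τ (a * c⁻¹) x • permute x⁻¹ (τ c) := by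
  induction x using weylGroup_induction b generalizing a with
  | one =>
    rw [Finset.sum_eq_single_of_mem a (by simpa using LeftWeakLE.refl b a)]
    · simp [schubert_one hτ]
    · intro c _ hc
      rw [schubert_apply_one hτ, if_neg (by rw [mul_inv_eq_one]; exact Ne.symm hc), zero_smul]
  | step i hi x _ ih =>
    have hperm : ∀ a, permute (ofIdx P i) (τ a) = ∑ c : P.weylGroup, if LeftWeakLE b c a then
        symAct (ofIdx P i) (τ (a * c⁻¹) x) • permute (ofIdx P i * x)⁻¹ (τ c) else 0 := fun a => by
      rw [← Finset.sum_filter]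
      conv_lhs => rw [ih a]
      rw [permute_sum_smul]
      simp only [ofIdx_inv, mul_inv_rev, permute_mul]
    rw [schubert_eq_permute_ofIdx hτ a hi, hperm, hperm, Finset.smul_sum, ite_sum_zero,
      ← Finset.sum_add_distrib, Finset.sum_filter]
    refine Finset.sum_congr rfl fun c _ => ?_
    -- The contributions of `a` and `s_i a` to the coefficient at `c` add up to `τ_{a c⁻¹}(s_i x)`.
    rw [smul_ite, smul_zero, ← ite_and, if_congr (leftWeakLE_ofIdx_mul_iff hi) rfl rfl,
      schubert_apply_ofIdx_mul hτ (a * c⁻¹) x hi]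
    by_cases hca : LeftWeakLE b c a
    · by_cases hlt : length b (ofIdx P i * (a * c⁻¹)) < length b (a * c⁻¹)
      · simp only [hca, hlt, and_self, if_true, add_smul, mul_smul, mul_assoc]
      · simp only [hca, hlt, and_false, if_true, if_false, add_zero]
    · simp only [hca, false_and, if_false, add_zero]

theorem permute_schubert_eq_sum (x a : P.weylGroup) :
    permute x⁻¹ (τ a) = ∑ c : P.weylGroup with LeftWeakLE b c a,
      ((-1) ^ length b (c * a⁻¹) * τ (c * a⁻¹) x) • τ c := by
  induction x using weylGroup_induction b generalizing a with
  | one =>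
    rw [Finset.sum_eq_single_of_mem a (by simpa using LeftWeakLE.refl b a)]
    · simp [schubert_one hτ, length_one]
    · intro c _ hc
      rw [schubert_apply_one hτ, if_neg (by rwa [mul_inv_eq_one]), mul_zero, zero_smul]
  | step i hi x _ ih =>
    set C : P.weylGroup → SymmetricAlgebra ℝ M := fun c =>
      symAct (ofIdx P i) ((-1) ^ length b (c * a⁻¹) * τ (c * a⁻¹) x) with hC
    have h₁ : permute (ofIdx P i * x)⁻¹ (τ a) =
        ∑ c : P.weylGroup, (if LeftWeakLE b c a then C c • τ c else 0) -
        ∑ c : P.weylGroup,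
          if LeftWeakLE b c a ∧ length b (ofIdx P i * c) < length b c then
            (C c * SymmetricAlgebra.ι ℝ M (P.root i)) • τ (ofIdx P i * c) else 0 := by
      rw [mul_inv_rev, ofIdx_inv, permute_mul, ih, permute_sum_smul, Finset.sum_filter,
        ← Finset.sum_sub_distrib]
      refine Finset.sum_congr rfl fun c _ => ?_
      rw [permute_ofIdx_schubert hτ c hi, ofIdx_inv, ite_and]
      split_ifs <;> simp [hC, smul_sub, mul_smul]
    -- Substituting `c ↦ s_i c` in the correction sum collects the coefficient of `τ c`.
    rw [h₁, ← Equiv.sum_comp (Equiv.mulLeft (ofIdx P i)) (fun c =>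
      if LeftWeakLE b c a ∧ length b (ofIdx P i * c) < length b c then _ else _),
      ← Finset.sum_sub_distrib, Finset.sum_filter]
    refine Finset.sum_congr rfl fun c _ => ?_
    simp only [Equiv.coe_mulLeft, ofIdx_mul_cancel_left]
    rw [if_congr (ofIdx_mul_leftWeakLE_iff hi) rfl rfl, schubert_apply_ofIdx_mul hτ _ x hi]
    by_cases hca : LeftWeakLE b c a
    · by_cases hlt : length b (ofIdx P i * (c * a⁻¹)) < length b (c * a⁻¹)
      · have hlen := length_ofIdx_mul (c * a⁻¹) hi
        have hlen' : length b (c * a⁻¹) = length b (ofIdx P i * (c * a⁻¹)) + 1 := by omega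
        simp only [hca, hlt, and_self, if_true, hC, mul_assoc, ← sub_smul]
        -- The length drop by one absorbs the minus sign of the correction.
        rw [← mul_assoc, mul_assoc, hlen']
        congr 1
        simp only [map_mul, map_pow, map_neg, map_one]
        ring
      · simp [hca, hlt, hC]
    · simp only [hca, false_and, if_false, sub_zero]

end Recursion

end Existence

section Basis
variable [Finite ι] [P.IsRootSystem] [P.IsCrystallographic] [P.IsReduced] {b : P.Base}
variable {τ : P.weylGroup → P.weylGroup → SymmetricAlgebra ℝ M}

/-! ### Bases -/

/-- The values are triangular for the length, with nonzero diagonal in a domain. -/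
theorem linearIndependent_schubert (hτ : ∀ u, IsSchubertClass b u (τ u)) :
    LinearIndependent (SymmetricAlgebra ℝ M) τ := by
  rw [Fintype.linearIndependent_iff]
  intro c hc u
  induction hn : length b u using Nat.strong_induction_on generalizing u with
  | _ n ih =>
    have h := congrFun hc u
    rw [Finset.sum_apply, Finset.sum_eq_single_of_mem u (Finset.mem_univ u)] at h
    · rw [Pi.smul_apply, smul_eq_mul, (hτ u).apply_eq_inversionProd, Pi.zero_apply] at h
      exact (mul_eq_zero.1 h).resolve_right (inversionProd_ne_zero b u)
    · intro v _ hv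
      rw [Pi.smul_apply]
      by_cases hlt : length b v < length b u
      · rw [ih _ (hn ▸ hlt) v rfl, zero_smul]
      · rw [(hτ v).eq_zero (not_lt.1 hlt) hv, smul_zero]

theorem mem_span_schubert (hτ : ∀ u, IsSchubertClass b u (τ u))
    {f : P.weylGroup → SymmetricAlgebra ℝ M} (hf : f ∈ cohomology b) :
    f ∈ Submodule.span (SymmetricAlgebra ℝ M) (Set.range τ) := by
  obtain ⟨n, hn⟩ := exists_length_le b
  -- The support is cleared one length at a time, shortest first; at `k = n + 1` the vanishing
  -- condition is vacuous.
  suffices H : ∀ k, ∀ f ∈ cohomology b, (∀ v, length b v + k ≤ n → f v = 0) →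
      f ∈ Submodule.span (SymmetricAlgebra ℝ M) (Set.range τ) from
    H (n + 1) f hf fun v hv => by omega
  intro k
  induction k with
  | zero =>
    intro f _ h0
    rw [show f = 0 from funext fun v => h0 v (hn v)]
    exact zero_mem _
  | succ k ih =>
    intro f hf h0
    have hq : ∀ v : P.weylGroup, ∃ q, length b v + k = n → f v = inversionProd b v * q := fun v => by
      by_cases hv : length b v + k = n
      · obtain ⟨q, hq⟩ := inversionProd_dvd hf (v := v) fun v' hv' => h0 v' (by omega)
        exact ⟨q, fun _ => hq⟩
      · exact ⟨0, fun h => absurd h hv⟩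
    choose q hq using hq
    have hmem : ∑ v : P.weylGroup with length b v + k = n, q v • τ v
        ∈ Submodule.span (SymmetricAlgebra ℝ M) (Set.range τ) :=
      sum_mem fun v _ => Submodule.smul_mem _ _ (Submodule.subset_span ⟨v, rfl⟩)
    rw [← Submodule.sub_mem_iff_left _ hmem]
    refine ih _ (sub_mem hf (sum_mem fun v _ =>
      Subalgebra.smul_mem _ (hτ v).mem_cohomology _)) fun w hw => ?_
    rw [Pi.sub_apply, Finset.sum_apply, sub_eq_zero]
    by_cases hwk : length b w + k = n
    · rw [Finset.sum_eq_single_of_mem w (by simpa using hwk), hq w hwk, Pi.smul_apply,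
        (hτ w).apply_eq_inversionProd, smul_eq_mul, mul_comm]
      intro v hv hvw
      simp only [Finset.mem_filter, Finset.mem_univ, true_and] at hv
      rw [Pi.smul_apply, (hτ v).eq_zero (by omega) hvw, smul_zero]
    · rw [h0 w (by omega), Finset.sum_eq_zero]
      intro v hv
      simp only [Finset.mem_filter, Finset.mem_univ, true_and] at hv
      rw [Pi.smul_apply, (hτ v).eq_zero (by omega) (by rintro rfl; omega), smul_zero]

theorem isCohomologyBasis_schubert (hτ : ∀ u, IsSchubertClass b u (τ u)) :
    IsCohomologyBasis b τ := by
  refine ⟨linearIndependent_schubert hτ, le_antisymm ?_ fun f hf => mem_span_schubert hτ hf⟩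
  rw [Submodule.span_le]
  rintro _ ⟨u, rfl⟩
  exact (hτ u).mem_cohomology

/-- `permute w` is semilinear and invertible, so a relation can be pulled back by `w⁻¹`. -/
theorem linearIndependent_permute {κ : Type*} [Fintype κ]
    {f : κ → P.weylGroup → SymmetricAlgebra ℝ M}
    (hf : LinearIndependent (SymmetricAlgebra ℝ M) f) (w : P.weylGroup) :
    LinearIndependent (SymmetricAlgebra ℝ M) fun i => permute w (f i) := by
  rw [Fintype.linearIndependent_iff] at hf ⊢
  intro c hc i
  have h := congrArg (Schubert.permute w⁻¹) hc
  simp only [permute_sum_smul, permute_zero, ← permute_mul, mul_inv_cancel, permute_one,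
    inv_inv] at h
  have h0 := congrArg (symAct w⁻¹) (hf _ h i)
  rwa [← symAct_mul, inv_mul_cancel, symAct_one, map_zero] at h0

/-! ### Transition matrices -/

theorem schubert_eq_sum_matrixToPermuted (hτ : ∀ u, IsSchubertClass b u (τ u))
    (w u : P.weylGroup) : τ u = ∑ v, matrixToPermuted b τ w u v • permute w (τ v) := by
  conv_lhs => rw [schubert_eq_sum_permute hτ w⁻¹ u]
  simp only [Finset.sum_filter, matrixToPermuted, inv_inv, ite_smul, zero_smul]

theorem permute_schubert_eq_sum_matrixFromPermuted (hτ : ∀ u, IsSchubertClass b u (τ u))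
    (w u : P.weylGroup) : permute w (τ u) = ∑ v, matrixFromPermuted b τ w u v • τ v := by
  have := permute_schubert_eq_sum hτ w⁻¹ u
  rw [inv_inv] at this
  rw [this]
  simp only [Finset.sum_filter, matrixFromPermuted, ite_smul, zero_smul]

theorem isCohomologyBasis_permute_schubert (hτ : ∀ u, IsSchubertClass b u (τ u))
    (w : P.weylGroup) : IsCohomologyBasis b fun u => permute w (τ u) := by
  refine ⟨linearIndependent_permute (linearIndependent_schubert hτ) w, ?_⟩
  rw [← (isCohomologyBasis_schubert hτ).2]
  apply le_antisymm <;> rw [Submodule.span_le] <;> rintro _ ⟨u, rfl⟩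
  · change permute w (τ u) ∈ _
    rw [permute_schubert_eq_sum_matrixFromPermuted hτ]
    exact sum_mem fun v _ => Submodule.smul_mem _ _ (Submodule.subset_span ⟨v, rfl⟩)
  · rw [schubert_eq_sum_matrixToPermuted hτ w u]
    exact sum_mem fun v _ => Submodule.smul_mem _ _ (Submodule.subset_span ⟨v, rfl⟩)

theorem matrixToPermuted_mul_matrixFromPermuted (hτ : ∀ u, IsSchubertClass b u (τ u))
    (w : P.weylGroup) : matrixToPermuted b τ w * matrixFromPermuted b τ w = 1 := by
  -- Expanding `τ u` in permuted classes and back again gives `τ u`; independence then compares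
  -- coefficients.
  have key : ∀ u, ∑ v, (matrixToPermuted b τ w * matrixFromPermuted b τ w) u v • τ v
      = ∑ v, (1 : Matrix P.weylGroup P.weylGroup (SymmetricAlgebra ℝ M)) u v • τ v := fun u => by
    simp only [Matrix.mul_apply, Finset.sum_smul, mul_smul, Matrix.one_apply, ite_smul, one_smul,
      zero_smul, Finset.sum_ite_eq, Finset.mem_univ, if_true]
    rw [Finset.sum_comm]
    simp only [← Finset.smul_sum, ← permute_schubert_eq_sum_matrixFromPermuted hτ]
    exact (schubert_eq_sum_matrixToPermuted hτ w u).symm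
  ext u v
  exact Fintype.linearIndependent_iffₛ.1 (linearIndependent_schubert hτ) _ _ (key u) v

theorem isUnitriangular_matrixToPermuted (hτ : ∀ u, IsSchubertClass b u (τ u))
    (w : P.weylGroup) : IsUnitriangular b (matrixToPermuted b τ w) := by
  refine ⟨fun u => ?_, fun u v h => ?_⟩
  · simp [matrixToPermuted, LeftWeakLE.refl b u, schubert_one hτ]
  · by_contra hvu
    exact h (if_neg hvu)

theorem isUnitriangular_matrixFromPermuted (hτ : ∀ u, IsSchubertClass b u (τ u))
    (w : P.weylGroup) : IsUnitriangular b (matrixFromPermuted b τ w) := by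
  refine ⟨fun u => ?_, fun u v h => ?_⟩
  · simp [matrixFromPermuted, LeftWeakLE.refl b u, schubert_one hτ, length_one]
  · by_contra hvu
    exact h (if_neg hvu)

end Basis

end Schubert

theorem mainTheorem9 {ι M N : Type*} [Finite ι] [AddCommGroup M] [Module ℝ M]
    [AddCommGroup N] [Module ℝ N] (P : RootPairing ι ℝ M N) [P.IsRootSystem]
    [P.IsCrystallographic] [P.IsReduced] (b : P.Base) :
    (∀ u : P.weylGroup, ∃! f : P.weylGroup → SymmetricAlgebra ℝ M,
      Schubert.IsSchubertClass b u f) ∧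
    ∀ τ : P.weylGroup → P.weylGroup → SymmetricAlgebra ℝ M,
      (∀ u, Schubert.IsSchubertClass b u (τ u)) →
      (∀ a w : P.weylGroup,
        τ a = ∑ c : P.weylGroup with Schubert.LeftWeakLE b c a,
          τ (a * c⁻¹) w⁻¹ • Schubert.permute w (τ c)) ∧
      (∀ a w : P.weylGroup,
        Schubert.permute w (τ a) = ∑ c : P.weylGroup with Schubert.LeftWeakLE b c a,
          ((-1) ^ Schubert.length b (c * a⁻¹) * τ (c * a⁻¹) w⁻¹) • τ c) ∧
      Schubert.IsCohomologyBasis b τ ∧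
      ∀ w : P.weylGroup,
        Schubert.IsCohomologyBasis b (fun u => Schubert.permute w (τ u)) ∧
        Schubert.IsUnitriangular b (Schubert.matrixToPermuted b τ w) ∧
        Schubert.IsUnitriangular b (Schubert.matrixFromPermuted b τ w) ∧
        Schubert.matrixToPermuted b τ w * Schubert.matrixFromPermuted b τ w = 1 ∧
        Schubert.matrixFromPermuted b τ w * Schubert.matrixToPermuted b τ w = 1 := by
  refine ⟨fun u => ?_, fun τ hτ => ⟨fun a w => ?_, fun a w => ?_,
    Schubert.isCohomologyBasis_schubert hτ, fun w => ?_⟩⟩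
  · obtain ⟨f, hf⟩ := Schubert.exists_isSchubertClass b u
    exact ⟨f, hf, fun g hg => hg.unique hf⟩
  · simpa using Schubert.schubert_eq_sum_permute hτ w⁻¹ a
  · simpa using Schubert.permute_schubert_eq_sum hτ w⁻¹ a
  · have h := Schubert.matrixToPermuted_mul_matrixFromPermuted hτ w
    exact ⟨Schubert.isCohomologyBasis_permute_schubert hτ w,
      Schubert.isUnitriangular_matrixToPermuted hτ w,
      Schubert.isUnitriangular_matrixFromPermuted hτ w, h, mul_eq_one_comm.1 h⟩
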